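/- Let $ID$ be the set of infinitely divisible probability measures on $\mathbb{R}^d$, let $T_a$ ($a\in\mathbb{R}$) denote the dilation $x\mapsto ax$ acting on measures, and for $\nu\in ID$, $c>0$ let $\nu^{*c}$ be the probability measure with characteristic function $\exp(c\log\hat\nu)$, where $\log\hat\nu$ is the continuous logarithm of $\hat\nu$ vanishing at $0$. Let $\mathcal{K}\subseteq ID$ be closed under weak convergence, convolution, all dilations $T_a$, $a\in\mathbb{R}$, and all convolution powers $\nu\mapsto\nu^{*c}$, $c>0$. Let $\nu\in\mathcal{K}$ and let $Y$ be a Lévy process in $\mathbb{R}^d$ (stationary independent increments, càdlàg paths, $Y(0)=0$ a.s.) with time set $\mathbb{T}=[0,\infty)$ or, in the two-sided case, $\mathbb{T}=\mathbb{R}$, such that $Y(1)$ has law $\nu$. For real functions $h,r$ and $a<b$ such that $h$ has bounded variation on $[a,b]$ and $r$ is piecewise monotone on $[a,b]$ with values in $\mathbb{T}$, put $$\int_{(a,b]}h(t)\,dY(r(t)):=h(b)\bigl(Y(r(b))-Y(r(a))\bigr)-\int_{(a,b]}\bigl(Y(r(t)-)-Y(r(a))\bigr)\,dh(t),$$ where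 $Y(r(t)-)=\lim_{s\uparrow t}Y(r(s))$ and $dh$ is the Lebesgue–Stieltjes signed measure of $h$ restricted to $[a,b]$. The integral is called well defined if, almost surely, these left limits exist for all $t\in(a,b]$ and the integrand is $dh$-integrable over $(a,b]$. (For $h$ right continuous at $a$ the right-hand side is $h(b)Y(r(b))-h(a)Y(r(a))-\int_{(a,b]}Y(r(t)-)\,dh(t)$.) Then: 1. If $\int_{(a,b]}h(t)\,dY(r(t))$ is well defined, then it is a random vector whose law $I^{h,r}_{(a,b]}(\nu)$ belongs to $\mathcal{K}$. 2. The same holds for improper integrals over the half-lines $(a,\infty)$ and $(-\infty,b]$ and over the line $\mathbb{R}$: if the integrals over all finite intervals $(a,b]$ of the half-line with the given endpoint (respectively, over all finite $(a,b]$) are well defined and converge in distribution to a probability measure $\rho$ as $b\to\infty$ (respectively as $a\to-\infty$; as $a\to-\infty$ and $b\to\infty$ jointly), then $\rho\in\mathcal{K}$. -/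

import Mathlib

open MeasureTheory ProbabilityTheory Set Filter Topology
open scoped BoundedContinuousFunction

namespace RandomIntegral

section Laws

variable {d : ℕ}

/-- The `n`-fold convolution `μ ∗ ⋯ ∗ μ` (the Dirac mass at `0` for `n = 0`). -/
noncomputable def iteratedConv (μ : Measure (EuclideanSpace ℝ (Fin d))) :
    ℕ → Measure (EuclideanSpace ℝ (Fin d))
  | 0 => Measure.dirac 0
  | n + 1 => Measure.conv (iteratedConv μ n) μ

/-- `ν` is infinitely divisible: it has an `n`-th convolution root for every `n ≥ 1`. -/
def IsInfinitelyDivisible (ν : ProbabilityMeasure (EuclideanSpace ℝ (Fin d))) : Prop :=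
  ∀ n : ℕ, 0 < n → ∃ μ : ProbabilityMeasure (EuclideanSpace ℝ (Fin d)),
    iteratedConv (μ : Measure (EuclideanSpace ℝ (Fin d))) n = ν

/-- The convolution `μ ∗ ν` of two probability measures. -/
noncomputable def conv (μ ν : ProbabilityMeasure (EuclideanSpace ℝ (Fin d))) :
    ProbabilityMeasure (EuclideanSpace ℝ (Fin d)) :=
  ⟨Measure.conv (μ : Measure (EuclideanSpace ℝ (Fin d))) ν, inferInstance⟩

/-- The dilation `T_a ν`: the image of `ν` under `x ↦ a x`. -/
noncomputable def dilation (a : ℝ) (ν : ProbabilityMeasure (EuclideanSpace ℝ (Fin d))) :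
    ProbabilityMeasure (EuclideanSpace ℝ (Fin d)) :=
  ν.map (f := fun x ↦ a • x) (measurable_const_smul a).aemeasurable

/-- `μ = ν^{∗ c}`: the characteristic function of `μ` is `exp (c φ)`, where `φ = log ν̂` is the
continuous logarithm of the characteristic function of `ν` that vanishes at `0`. -/
def IsConvPower (ν : ProbabilityMeasure (EuclideanSpace ℝ (Fin d))) (c : ℝ)
    (μ : ProbabilityMeasure (EuclideanSpace ℝ (Fin d))) : Prop :=
  ∃ φ : EuclideanSpace ℝ (Fin d) → ℂ, Continuous φ ∧ φ 0 = 0 ∧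
    (∀ y, charFun (ν : Measure (EuclideanSpace ℝ (Fin d))) y = Complex.exp (φ y)) ∧
    ∀ y, charFun (μ : Measure (EuclideanSpace ℝ (Fin d))) y = Complex.exp (c * φ y)

end Laws

/-- A Lévy process with time set `T` (used for `T = [0, ∞)` and for `T = ℝ`, the two-sided case)
whose law at time `1` is `ν`. The values `Y t` for `t ∉ T` play no role. -/
structure IsLevyProcess {d : ℕ} {Ω : Type*} [MeasurableSpace Ω] (T : Set ℝ)
    (Y : ℝ → Ω → EuclideanSpace ℝ (Fin d)) (P : Measure Ω)
    (ν : ProbabilityMeasure (EuclideanSpace ℝ (Fin d))) : Prop where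
  measurable : ∀ t ∈ T, Measurable (Y t)
  zero : ∀ᵐ ω ∂P, Y 0 ω = 0
  indep_increments : HasIndepIncrements (fun t : T ↦ Y t) P
  stationary_increments : ∀ s ∈ T, ∀ t ∈ T, s ≤ t →
    IdentDistrib (fun ω ↦ Y t ω - Y s ω) (Y (t - s)) P P
  right_continuous : ∀ᵐ ω ∂P, ∀ t ∈ T, ContinuousWithinAt (fun s ↦ Y s ω) (Ici t) t
  left_limits : ∀ᵐ ω ∂P, ∀ t ∈ T, ∃ l, Tendsto (fun s ↦ Y s ω) (𝓝[T ∩ Iio t] t) (𝓝 l)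
  law_one : HasLaw (Y 1) ν P

/-- `r` is piecewise monotone on `[a, b]`: there is a partition `a = t₀ ≤ ⋯ ≤ tₙ = b` such that `r`
is monotone (increasing or decreasing) on each open interval `(tᵢ, tᵢ₊₁)`. -/
def PiecewiseMonotone (r : ℝ → ℝ) (a b : ℝ) : Prop :=
  ∃ (n : ℕ) (t : ℕ → ℝ), Monotone t ∧ t 0 = a ∧ t n = b ∧
    ∀ i < n, MonotoneOn r (Ioo (t i) (t (i + 1))) ∨ AntitoneOn r (Ioo (t i) (t (i + 1)))

/-- The restriction of `h` to `[a, b]`, extended to `ℝ` by the constants `h a` and `h b`. -/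
def clamp (h : ℝ → ℝ) (a b : ℝ) : ℝ → ℝ := fun t ↦ h (max a (min b t))

theorem boundedVariationOn_clamp {h : ℝ → ℝ} {a b : ℝ} (hab : a ≤ b)
    (hh : BoundedVariationOn h (Icc a b)) : BoundedVariationOn (clamp h a b) univ := by
  have key := eVariationOn.comp_le_of_monotoneOn h (s := Icc a b) (t := univ)
    (fun t : ℝ ↦ max a (min b t))
    (fun x _ y _ hxy ↦ max_le_max le_rfl (min_le_min le_rfl hxy))
    (fun x _ ↦ ⟨le_max_left _ _, max_le hab (min_le_left _ _)⟩)
  exact ne_top_of_le_ne_top hh key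

open Classical in
/-- The Lebesgue-Stieltjes signed measure `dh` of a function `h` of bounded variation on `[a, b]`
(it is carried by `[a, b]`). -/
noncomputable def stieltjes (h : ℝ → ℝ) (a b : ℝ) : SignedMeasure ℝ :=
  if H : a ≤ b ∧ BoundedVariationOn h (Icc a b) then
    (boundedVariationOn_clamp H.1 H.2).vectorMeasure
  else 0

section Integral

variable {d : ℕ} {Ω : Type*}

/-- The integrand `Y(r(t)-) - Y(r(a))`, with the left limit of `s ↦ Y(r(s))` at `t`. -/
noncomputable def integrand (r : ℝ → ℝ) (a : ℝ) (Y : ℝ → Ω → EuclideanSpace ℝ (Fin d)) (ω : Ω)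
    (t : ℝ) : EuclideanSpace ℝ (Fin d) :=
  Function.leftLim (fun s ↦ Y (r s) ω) t - Y (r a) ω

/-- The random integral `∫_{(a,b]} h(t) dY(r(t))`, defined pathwise by formal integration by parts:
`h(b) (Y(r(b)) - Y(r(a))) - ∫_{(a,b]} (Y(r(t)-) - Y(r(a))) dh(t)`.
When `h` is right continuous at `a`, so that `dh` has mass `h(b) - h(a)` on `(a,b]`, this equals
`h(b) Y(r(b)) - h(a) Y(r(a)) - ∫_{(a,b]} Y(r(t)-) dh(t)`. -/
noncomputable def randomIntegral (h r : ℝ → ℝ) (a b : ℝ)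
    (Y : ℝ → Ω → EuclideanSpace ℝ (Fin d)) (ω : Ω) : EuclideanSpace ℝ (Fin d) :=
  h b • (Y (r b) ω - Y (r a) ω) - ∫ᵛ t in Ioc a b, integrand r a Y ω t ∂<•(stieltjes h a b)

/-- The random integral `∫_{(a,b]} h(t) dY(r(t))` is well defined: `h` has bounded variation on
`[a, b]`, `r` is a piecewise monotone time change with values in the time set `T` of `Y`, and almost
surely the left limits `Y(r(t)-)` exist for all `t ∈ (a, b]` and are `dh`-integrable over `(a, b]`.
-/
structure IsWellDefined [MeasurableSpace Ω] (T : Set ℝ) (h r : ℝ → ℝ) (a b : ℝ)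
    (Y : ℝ → Ω → EuclideanSpace ℝ (Fin d)) (P : Measure Ω) : Prop where
  boundedVariation : BoundedVariationOn h (Icc a b)
  mapsTo : MapsTo r (Icc a b) T
  piecewiseMonotone : PiecewiseMonotone r a b
  left_limits : ∀ᵐ ω ∂P, ∀ t ∈ Ioc a b, ∃ l, Tendsto (fun s ↦ Y (r s) ω) (𝓝[<] t) (𝓝 l)
  integrable : ∀ᵐ ω ∂P, (stieltjes h a b).IntegrableOn (integrand r a Y ω) (Ioc a b)

/-- The random vectors `X i` converge in distribution to the law `ρ` along the filter `l`. -/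
def ConvergesInLaw {ι : Type*} [MeasurableSpace Ω] (X : ι → Ω → EuclideanSpace ℝ (Fin d))
    (l : Filter ι) (P : Measure Ω) (ρ : ProbabilityMeasure (EuclideanSpace ℝ (Fin d))) : Prop :=
  ∀ f : EuclideanSpace ℝ (Fin d) →ᵇ ℝ,
    Tendsto (fun i ↦ ∫ ω, f (X i ω) ∂P) l
      (𝓝 (∫ x, f x ∂(ρ : Measure (EuclideanSpace ℝ (Fin d)))))

end Integral

end RandomIntegral

open RandomIntegral

/-!
The proof combines three facts about a Lévy process `Y` with `Y 1` of law `ν ∈ K`.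

* Every finite linear combination of increments of `Y` has its law in `K`
  (`IsLevyProcess.hasLawIn_of_mem_incrementSpan`): it is a combination of increments over
  consecutive intervals, which are independent, and an increment over an interval of length `t` has
  law `ν^{∗ t}`, because the characteristic function of `Y t` is the `t`-th power of that of `Y 1`
  (`IsLevyProcess.exists_charFun_eq_exp`). As `K` is closed, the almost sure limits of sequences of
  such combinations have their laws in `K` too.
* These almost sure limits form a linear space that is itself closed under almost sure limits
  (`mem_aeLimits_of_tendsto`), and under integration over a parameter
  (`integral_mem_aeLimits`): if `F (ω, t)` is jointly measurable and almost surely integrable in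
  `t` with respect to a probability measure `μ`, and each `F (·, t)` lies in the space, then by the
  strong law of large numbers and Fubini's theorem there is one fixed sequence of
  points `t i` along which the averages of `F (·, t i)` converge almost surely to `∫ F (·, t) dμ(t)`. This needs no domination of
  the integrand, hence no control of the time change `r` where it is unbounded.
* The integrand `Y(r(t)-) - Y(r(a))` is, for each `t`, the limit of the increments
  `Y(r(s)) - Y(r(a))` for grid points `s` tending to `t` from the left. As the grids
  are countable, these approximations, and so their limit, are jointly measurable
  (`IsWellDefined.exists_measurable_integrand`).

Hence the random integral is an almost sure limit of linear combinations of increments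
(`IsWellDefined.randomIntegral_mem_aeLimits`). The improper integrals are limits in distribution,
and `K` is closed.
-/

namespace RandomIntegral

/-! ### Almost sure limits and integration over a parameter -/

section AELimits

variable {Ω E : Type*} [MeasurableSpace Ω] {P : Measure Ω} [NormedAddCommGroup E]
  [NormedSpace ℝ E]

/-- The space of all maps that are almost everywhere limits of sequences in `V`. -/
def aeLimits (V : Submodule ℝ (Ω → E)) (P : Measure Ω) : Submodule ℝ (Ω → E) where
  carrier := {X | ∃ u : ℕ → Ω → E, (∀ n, u n ∈ V) ∧
    ∀ᵐ ω ∂P, Tendsto (fun n ↦ u n ω) atTop (𝓝 (X ω))}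
  zero_mem' := ⟨0, fun _ ↦ V.zero_mem, .of_forall fun _ ↦ tendsto_const_nhds⟩
  add_mem' := by
    rintro X Z ⟨u, hu, hX⟩ ⟨v, hv, hZ⟩
    refine ⟨u + v, fun n ↦ V.add_mem (hu n) (hv n), ?_⟩
    filter_upwards [hX, hZ] with ω h₁ h₂ using h₁.add h₂
  smul_mem' := by
    rintro c X ⟨u, hu, hX⟩
    refine ⟨c • u, fun n ↦ V.smul_mem c (hu n), ?_⟩
    filter_upwards [hX] with ω h₁ using h₁.const_smul c

variable {V : Submodule ℝ (Ω → E)}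

lemma le_aeLimits : V ≤ aeLimits V P :=
  fun X hX ↦ ⟨fun _ ↦ X, fun _ ↦ hX, .of_forall fun _ ↦ tendsto_const_nhds⟩

lemma aeLimits_congr {X Z : Ω → E} (hX : X ∈ aeLimits V P) (h : X =ᵐ[P] Z) :
    Z ∈ aeLimits V P := by
  obtain ⟨u, hu, hlim⟩ := hX
  refine ⟨u, hu, ?_⟩
  filter_upwards [hlim, h] with ω h₁ h₂ using h₂ ▸ h₁

variable [MeasurableSpace E] [BorelSpace E]

lemma aemeasurable_of_mem_aeLimits (hV : ∀ X ∈ V, AEMeasurable X P) {X : Ω → E}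
    (hX : X ∈ aeLimits V P) : AEMeasurable X P := by
  obtain ⟨u, hu, hlim⟩ := hX
  exact aemeasurable_of_tendsto_metrizable_ae atTop (fun n ↦ hV _ (hu n)) hlim

variable [SecondCountableTopology E]

/-- Taking almost everywhere limits twice yields nothing new: on a finite measure space, almost
everywhere convergence of sequences can be traded for convergence in measure, for which
a diagonal argument is available. -/
lemma mem_aeLimits_of_tendsto [IsFiniteMeasure P] (hV : ∀ X ∈ V, AEMeasurable X P)
    {u : ℕ → Ω → E} {X : Ω → E} (hu : ∀ n, u n ∈ aeLimits V P)
    (hlim : ∀ᵐ ω ∂P, Tendsto (fun n ↦ u n ω) atTop (𝓝 (X ω))) : X ∈ aeLimits V P := by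
  have h₁ : TendstoInMeasure P u atTop X := tendstoInMeasure_of_tendsto_ae
    (fun n ↦ (aemeasurable_of_mem_aeLimits hV (hu n)).aestronglyMeasurable) hlim
  obtain ⟨δ, -, hδpos, hδ⟩ := exists_seq_strictAnti_tendsto' (show (0 : ENNReal) < 1 by simp)
  have h₂ : ∀ k, ∃ v ∈ V, P {ω | δ k ≤ edist (v ω) (u k ω)} < δ k := by
    intro k
    obtain ⟨w, hw, hwlim⟩ := hu k
    have h := tendstoInMeasure_of_tendsto_ae
      (fun n ↦ (hV _ (hw n)).aestronglyMeasurable) hwlim (δ k) (hδpos k).1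
    obtain ⟨n, hn⟩ := (h.eventually_lt_const (hδpos k).1).exists
    exact ⟨w n, hw n, hn⟩
  choose v hvV hv using h₂
  have h₃ : TendstoInMeasure P v atTop X := by
    intro ε hε
    have hε2 : 0 < ε / 2 := ENNReal.half_pos hε.ne'
    refine tendsto_of_tendsto_of_tendsto_of_le_of_le' tendsto_const_nhds
      (by simpa using hδ.add (h₁ _ hε2)) (.of_forall fun _ ↦ zero_le) ?_
    filter_upwards [hδ.eventually_lt_const hε2] with k hk
    calc P {ω | ε ≤ edist (v k ω) (X ω)}
        ≤ P ({ω | δ k ≤ edist (v k ω) (u k ω)} ∪ {ω | ε / 2 ≤ edist (u k ω) (X ω)}) := by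
          refine measure_mono fun ω hω ↦ ?_
          by_contra! hcon
          simp only [mem_union, mem_ofPred_eq, not_or, not_le] at hcon hω
          refine absurd hω (not_le.2 ?_)
          calc edist (v k ω) (X ω) ≤ edist (v k ω) (u k ω) + edist (u k ω) (X ω) :=
                edist_triangle _ _ _
            _ < ε / 2 + ε / 2 := ENNReal.add_lt_add (hcon.1.trans hk) hcon.2
            _ = ε := ENNReal.add_halves ε
      _ ≤ δ k + P {ω | ε / 2 ≤ edist (u k ω) (X ω)} :=
          (measure_union_le _ _).trans (add_le_add (hv k).le le_rfl)
  obtain ⟨ns, -, hns⟩ := h₃.exists_seq_tendsto_ae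
  exact ⟨fun n ↦ v (ns n), fun n ↦ hvV _, hns⟩

/-- A Monte Carlo argument: by the strong law of large numbers and Fubini's theorem, almost every
sequence of independent sampling points `t i` with law `μ` has the property that, for almost every
`ω`, the averages of `F (ω, t i)` converge to the integral of `F (ω, ·)`. -/
lemma exists_seq_tendsto_average [SFinite P] [CompleteSpace E] {S : Type*} [MeasurableSpace S]
    {μ : Measure S} [IsProbabilityMeasure μ] {F : Ω × S → E} (hF : Measurable F)
    (hint : ∀ᵐ ω ∂P, Integrable (fun s ↦ F (ω, s)) μ) {p : S → Prop} (hp : ∀ᵐ s ∂μ, p s) :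
    ∃ t : ℕ → S, (∀ i, p (t i)) ∧ ∀ᵐ ω ∂P, Tendsto
      (fun n : ℕ ↦ (n : ℝ)⁻¹ • ∑ i ∈ Finset.range n, F (ω, t i)) atTop
      (𝓝 (∫ s, F (ω, s) ∂μ)) := by
  let Q : Measure (ℕ → S) := Measure.infinitePi fun _ ↦ μ
  have heval (i : ℕ) : MeasurePreserving (fun t : ℕ → S ↦ t i) Q μ :=
    measurePreserving_eval_infinitePi (fun _ ↦ μ) i
  have hslln : ∀ᵐ ω ∂P, ∀ᵐ t ∂Q, Tendsto
      (fun n : ℕ ↦ (n : ℝ)⁻¹ • ∑ i ∈ Finset.range n, F (ω, t i)) atTop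
      (𝓝 (∫ s, F (ω, s) ∂μ)) := by
    filter_upwards [hint] with ω hω
    have hFω : Measurable fun s ↦ F (ω, s) := hF.comp measurable_prodMk_left
    have hind : iIndepFun (fun i (t : ℕ → S) ↦ F (ω, t i)) Q :=
      iIndepFun_infinitePi (X := fun _ s ↦ F (ω, s)) fun _ ↦ hFω
    have hmap (i : ℕ) : Q.map (fun t ↦ F (ω, t i)) = μ.map (fun s ↦ F (ω, s)) := by
      rw [← (heval i).map_eq, Measure.map_map hFω (heval i).measurable]; rfl
    have key := strong_law_ae (μ := Q) (fun i (t : ℕ → S) ↦ F (ω, t i))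
      ((heval 0).integrable_comp_of_integrable hω)
      (fun i j hij ↦ hind.indepFun hij)
      (fun i ↦ ⟨(hFω.comp (heval i).measurable).aemeasurable,
        (hFω.comp (heval 0).measurable).aemeasurable, by rw [hmap, hmap]⟩)
    have hmean : ∫ t, F (ω, t 0) ∂Q = ∫ s, F (ω, s) ∂μ := by
      rw [← (heval 0).map_eq, integral_map (heval 0).measurable.aemeasurable
        hFω.aestronglyMeasurable]
    rwa [hmean] at key
  have hmeas : MeasurableSet {x : Ω × (ℕ → S) | Tendsto
      (fun n : ℕ ↦ (n : ℝ)⁻¹ • ∑ i ∈ Finset.range n, F (x.1, x.2 i)) atTop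
      (𝓝 (∫ s, F (x.1, s) ∂μ))} := by
    have h₁ : Measurable fun x : Ω × (ℕ → S) ↦ ∫ s, F (x.1, s) ∂μ :=
      (hF.stronglyMeasurable.integral_prod_right' (ν := μ)).measurable.comp measurable_fst
    refine measurableSet_tendsto_fun (fun n ↦ ?_) h₁
    exact (Finset.measurable_sum _ fun i _ ↦ hF.comp (by fun_prop)).const_smul _
  have hswap := (Measure.ae_ae_comm (μ := P) (ν := Q) (p := fun ω t ↦ Tendsto
      (fun n : ℕ ↦ (n : ℝ)⁻¹ • ∑ i ∈ Finset.range n, F (ω, t i)) atTop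
      (𝓝 (∫ s, F (ω, s) ∂μ))) hmeas).1 hslln
  have hpQ : ∀ᵐ t ∂Q, ∀ i, p (t i) :=
    ae_all_iff.2 fun i ↦ (heval i).quasiMeasurePreserving.ae hp
  obtain ⟨t, h₁, h₂⟩ := (hpQ.and hswap).exists
  exact ⟨t, h₁, h₂⟩

lemma integral_mem_aeLimits [IsFiniteMeasure P] [CompleteSpace E]
    (hV : ∀ X ∈ V, AEMeasurable X P) {S : Type*} [MeasurableSpace S]
    {μ : Measure S} [IsFiniteMeasure μ] {F : Ω × S → E} (hF : Measurable F)
    (hint : ∀ᵐ ω ∂P, Integrable (fun s ↦ F (ω, s)) μ)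
    (hmem : ∀ᵐ s ∂μ, (fun ω ↦ F (ω, s)) ∈ aeLimits V P) :
    (fun ω ↦ ∫ s, F (ω, s) ∂μ) ∈ aeLimits V P := by
  rcases eq_or_neBot (ae μ) with h0 | hne
  · rw [ae_eq_bot] at h0
    subst h0
    simp only [integral_zero_measure]
    exact (aeLimits V P).zero_mem
  have hμ : μ ≠ 0 := by rwa [ne_eq, ← ae_eq_bot, ← ne_eq, ← neBot_iff]
  have : NeZero μ := ⟨hμ⟩
  let μ' : Measure S := (μ univ)⁻¹ • μ
  have hμ' : IsProbabilityMeasure μ' := inferInstance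
  have hc : (μ univ)⁻¹ ≠ ⊤ := by simpa using hμ
  obtain ⟨t, ht, hlim⟩ := exists_seq_tendsto_average (P := P) (μ := μ') hF
    (hint.mono fun ω h ↦ h.smul_measure hc) (Measure.ae_smul_measure hmem _)
  have hmem' : (fun ω ↦ ∫ s, F (ω, s) ∂μ') ∈ aeLimits V P := by
    refine mem_aeLimits_of_tendsto hV
      (u := fun n ω ↦ (n : ℝ)⁻¹ • ∑ i ∈ Finset.range n, F (ω, t i)) (fun n ↦ ?_) hlim
    convert (aeLimits V P).smul_mem (n : ℝ)⁻¹
      ((aeLimits V P).sum_mem (t := Finset.range n) fun i _ ↦ ht i) using 1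
    ext ω
    simp
  convert (aeLimits V P).smul_mem (μ univ).toReal hmem' using 1
  ext1 ω
  simp only [μ', Pi.smul_apply, integral_smul_measure, smul_smul]
  rw [ENNReal.toReal_inv, mul_inv_cancel₀, one_smul]
  exact (ENNReal.toReal_ne_zero.2 ⟨by simpa using hμ, measure_ne_top _ _⟩)

/-- The version of `integral_mem_aeLimits` for a signed measure, by its Jordan decomposition. -/
lemma integral_signedMeasure_mem_aeLimits [IsFiniteMeasure P] [CompleteSpace E]
    (hV : ∀ X ∈ V, AEMeasurable X P) {S : Type*} [MeasurableSpace S]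
    {σ : SignedMeasure S} {F : Ω × S → E} (hF : Measurable F)
    (hint : ∀ᵐ ω ∂P, σ.Integrable (fun s ↦ F (ω, s)))
    (hmem : ∀ᵐ s ∂σ.variation, (fun ω ↦ F (ω, s)) ∈ aeLimits V P) :
    (fun ω ↦ ∫ᵛ s, F (ω, s) ∂<•σ) ∈ aeLimits V P := by
  set j := σ.toJordanDecomposition with hj
  have hvar : σ.variation = j.posPart + j.negPart := by
    rw [← SignedMeasure.totalVariation_eq_variation]; rfl
  have hσ : σ = j.posPart.toSignedMeasure - j.negPart.toSignedMeasure :=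
    σ.toSignedMeasure_toJordanDecomposition.symm
  rw [hvar, ae_add_measure_iff] at hmem
  have hint' : ∀ᵐ ω ∂P, Integrable (fun s ↦ F (ω, s)) j.posPart ∧
      Integrable (fun s ↦ F (ω, s)) j.negPart := by
    filter_upwards [hint] with ω hω
    rwa [VectorMeasure.Integrable, hvar, integrable_add_measure] at hω
  have h₁ := integral_mem_aeLimits hV hF (hint'.mono fun _ h ↦ h.1) hmem.1
  have h₂ := integral_mem_aeLimits hV hF (hint'.mono fun _ h ↦ h.2) hmem.2
  refine aeLimits_congr ((aeLimits V P).sub_mem h₁ h₂) ?_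
  filter_upwards [hint'] with ω hω
  conv_rhs => rw [hσ]
  rw [VectorMeasure.integral_sub_vectorMeasure]
  · simp
  · simpa [VectorMeasure.Integrable] using hω.1
  · simpa [VectorMeasure.Integrable] using hω.2

end AELimits

/-! ### Continuous logarithms -/

section ContinuousLogarithm

variable {E : Type*} [NormedAddCommGroup E] [NormedSpace ℝ E]

/-- A nowhere vanishing continuous function on a real normed space has a continuous logarithm:
the space is simply connected, so the function lifts through the covering map `exp`. -/
lemma exists_continuous_log {f : E → ℂ} (hf : Continuous f) (h0 : f 0 = 1)
    (hne : ∀ y, f y ≠ 0) :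
    ∃ φ : E → ℂ, Continuous φ ∧ φ 0 = 0 ∧ ∀ y, f y = Complex.exp (φ y) := by
  obtain ⟨φ, ⟨hφ0, hφ⟩, -⟩ := Complex.isCoveringMap_exp.existsUnique_continuousMap_lifts
    ⟨fun y ↦ (⟨f y, hne y⟩ : {z : ℂ // z ≠ 0}), by fun_prop⟩ (0 : E) (0 : ℂ) (by simp [h0])
  refine ⟨φ, φ.continuous, hφ0, fun y ↦ ?_⟩
  have := congrArg Subtype.val (congrFun hφ y)
  simpa using this.symm

/-- Two continuous `n`-th roots of the same nowhere vanishing function on a connected space agree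
as soon as they agree at a point; here one of them is given by a continuous logarithm. -/
lemma eq_exp_div_of_pow_eq_exp {f φ : E → ℂ} (hf : Continuous f) (h0 : f 0 = 1)
    (hφ : Continuous φ) (hφ0 : φ 0 = 0) {n : ℕ} (hn : n ≠ 0)
    (h : ∀ y, f y ^ n = Complex.exp (φ y)) (y : E) : f y = Complex.exp (φ y / n) := by
  have hn' : (n : ℂ) ≠ 0 := mod_cast hn
  have hroots : {z : ℂ | z ^ n = 1}.Finite := by
    refine (Polynomial.nthRootsFinset n (1 : ℂ)).finite_toSet.subset fun z hz ↦ ?_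
    simpa [Polynomial.mem_nthRootsFinset (Nat.pos_of_ne_zero hn)] using hz
  have := hroots.to_subtype
  have hg : Continuous fun y ↦ f y * Complex.exp (-(φ y / n)) := by fun_prop
  have key := isPreconnected_univ.constant_of_mapsTo (T := {z : ℂ | z ^ n = 1})
    ⟨inferInstance⟩ hg.continuousOn (fun x _ ↦ by
      simp only [mem_ofPred_eq]
      rw [mul_pow, h, ← Complex.exp_nat_mul, ← Complex.exp_add]
      field_simp
      simp) (mem_univ y) (mem_univ 0)
  simp only [h0, hφ0, zero_div, neg_zero, Complex.exp_zero, mul_one] at key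
  rw [Complex.exp_neg] at key
  exact (mul_inv_eq_one₀ (Complex.exp_ne_zero _)).1 key

end ContinuousLogarithm

/-! ### Random vectors with laws in a class of measures -/

section LawIn

variable {d : ℕ} {Ω : Type*} [MeasurableSpace Ω] {P : Measure Ω}

/-- The law of the random vector `X` belongs to `K`. -/
def HasLawIn (K : Set (ProbabilityMeasure (EuclideanSpace ℝ (Fin d))))
    (X : Ω → EuclideanSpace ℝ (Fin d)) (P : Measure Ω) : Prop :=
  ∃ ρ ∈ K, HasLaw X (ρ : Measure (EuclideanSpace ℝ (Fin d))) P

variable {K : Set (ProbabilityMeasure (EuclideanSpace ℝ (Fin d)))}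
  {X Z : Ω → EuclideanSpace ℝ (Fin d)}

lemma HasLawIn.congr (h : HasLawIn K X P) (hXZ : Z =ᵐ[P] X) : HasLawIn K Z P := by
  obtain ⟨ρ, hρ, hX⟩ := h
  exact ⟨ρ, hρ, hX.congr hXZ⟩

lemma HasLawIn.const_smul (hdil : ∀ (a : ℝ), ∀ ν ∈ K, dilation a ν ∈ K) (h : HasLawIn K X P)
    (c : ℝ) : HasLawIn K (c • X) P := by
  obtain ⟨ρ, hρ, hX⟩ := h
  refine ⟨dilation c ρ, hdil c ρ hρ, ?_⟩
  have hc : HasLaw (fun x : EuclideanSpace ℝ (Fin d) ↦ c • x)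
      (dilation c ρ : Measure (EuclideanSpace ℝ (Fin d))) ρ :=
    ⟨(measurable_const_smul c).aemeasurable, rfl⟩
  exact hc.comp hX

lemma HasLawIn.add (hconv : ∀ μ ∈ K, ∀ ν ∈ K, RandomIntegral.conv μ ν ∈ K)
    (hX : HasLawIn K X P) (hZ : HasLawIn K Z P) (hindep : X ⟂ᵢ[P] Z) :
    HasLawIn K (X + Z) P := by
  obtain ⟨ρ, hρ, hX⟩ := hX
  obtain ⟨σ, hσ, hZ⟩ := hZ
  exact ⟨conv ρ σ, hconv ρ hρ σ hσ, hindep.hasLaw_add hX hZ⟩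

variable [IsProbabilityMeasure P] {ν : ProbabilityMeasure (EuclideanSpace ℝ (Fin d))}

lemma hasLawIn_zero (hdil : ∀ (a : ℝ), ∀ ν ∈ K, dilation a ν ∈ K) (hν : ν ∈ K) :
    HasLawIn K (0 : Ω → EuclideanSpace ℝ (Fin d)) P := by
  refine ⟨dilation 0 ν, hdil 0 ν hν, ?_⟩
  have : (dilation 0 ν : Measure (EuclideanSpace ℝ (Fin d))) = Measure.dirac 0 := by
    simp [dilation, Measure.map_const]
  rw [this]
  exact hasLaw_dirac_of_ae_eq .rfl

lemma HasLawIn.sum (hconv : ∀ μ ∈ K, ∀ ν ∈ K, RandomIntegral.conv μ ν ∈ K)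
    (hdil : ∀ (a : ℝ), ∀ ν ∈ K, dilation a ν ∈ K) (hν : ν ∈ K) {ι : Type*} {s : Finset ι}
    {X : ι → Ω → EuclideanSpace ℝ (Fin d)} (hmeas : ∀ i, Measurable (X i))
    (hX : ∀ i, HasLawIn K (X i) P) (hindep : iIndepFun X P) :
    HasLawIn K (∑ i ∈ s, X i) P := by
  classical
  induction s using Finset.induction_on with
  | empty => simpa using hasLawIn_zero hdil hν
  | insert i s hi ih =>
    rw [Finset.sum_insert hi, add_comm]
    exact ih.add hconv (hX i) (hindep.indepFun_finsetSum_of_notMem hmeas hi)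

lemma HasLawIn.of_ae_tendsto (hclosed : IsClosed K) {u : ℕ → Ω → EuclideanSpace ℝ (Fin d)}
    (hu : ∀ n, HasLawIn K (u n) P)
    (hlim : ∀ᵐ ω ∂P, Tendsto (fun n ↦ u n ω) atTop (𝓝 (X ω))) : HasLawIn K X P := by
  choose ρ hρ hlaw using hu
  have hX : AEMeasurable X P :=
    aemeasurable_of_tendsto_metrizable_ae atTop (fun n ↦ (hlaw n).aemeasurable) hlim
  have hdist := tendstoInDistribution_of_ae_tendsto (fun n ↦ (hlaw n).aemeasurable) hX hlim
  refine ⟨⟨P.map X, Measure.isProbabilityMeasure_map hX⟩, ?_, hX, rfl⟩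
  refine hclosed.mem_of_tendsto hdist.tendsto (.of_forall fun n ↦ ?_)
  have : (⟨P.map (u n), Measure.isProbabilityMeasure_map (hlaw n).aemeasurable⟩ :
      ProbabilityMeasure (EuclideanSpace ℝ (Fin d))) = ρ n := Subtype.ext (hlaw n).map_eq
  exact this ▸ hρ n

end LawIn

/-! ### Increments of Lévy processes -/

section LevyProcess

variable {d : ℕ} {Ω : Type*} {T : Set ℝ} {Y : ℝ → Ω → EuclideanSpace ℝ (Fin d)}
  {X : Ω → EuclideanSpace ℝ (Fin d)}

/-- The linear span of the increments `Y t - Y 0`, `t ∈ T`. -/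
def incrementSpan (T : Set ℝ) (Y : ℝ → Ω → EuclideanSpace ℝ (Fin d)) :
    Submodule ℝ (Ω → EuclideanSpace ℝ (Fin d)) :=
  Submodule.span ℝ ((fun t ↦ Y t - Y 0) '' T)

lemma sub_mem_incrementSpan {s t : ℝ} (hs : s ∈ T) (ht : t ∈ T) :
    Y t - Y s ∈ incrementSpan T Y := by
  have h := (incrementSpan T Y).sub_mem (Submodule.subset_span (mem_image_of_mem _ ht))
    (Submodule.subset_span (mem_image_of_mem _ hs))
  simpa using h

variable [MeasurableSpace Ω] {P : Measure Ω} {ν : ProbabilityMeasure (EuclideanSpace ℝ (Fin d))}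

lemma IsLevyProcess.measurable_of_mem_incrementSpan (hY : IsLevyProcess T Y P ν)
    (hT : Ici 0 ⊆ T) (hX : X ∈ incrementSpan T Y) : Measurable X := by
  induction hX using Submodule.span_induction with
  | mem X h =>
    obtain ⟨t, ht, rfl⟩ := h
    exact (hY.measurable t ht).sub (hY.measurable 0 (hT self_mem_Ici))
  | zero => exact measurable_zero
  | add X Z _ _ h₁ h₂ => exact h₁.add h₂
  | smul c X _ h => exact h.const_smul c

variable [IsProbabilityMeasure P] {K : Set (ProbabilityMeasure (EuclideanSpace ℝ (Fin d)))}

lemma IsLevyProcess.charFun_add (hY : IsLevyProcess T Y P ν) (hT : Ici 0 ⊆ T) {s t : ℝ}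
    (hs : 0 ≤ s) (ht : 0 ≤ t) (y : EuclideanSpace ℝ (Fin d)) :
    charFun (P.map (Y (s + t))) y = charFun (P.map (Y s)) y * charFun (P.map (Y t)) y := by
  have hsT : s ∈ T := hT hs
  have hstT : s + t ∈ T := hT (add_nonneg hs ht)
  have hindep := hY.indep_increments.indepFun_eval_sub (r := ⟨0, hT self_mem_Ici⟩)
    (s := ⟨s, hsT⟩) (t := ⟨s + t, hstT⟩) hs (by simpa using ht) hY.zero
  have hdist := hY.stationary_increments s hsT (s + t) hstT (by linarith)
  rw [add_sub_cancel_left] at hdist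
  have hadd := hindep.charFun_map_add_eq_mul (hY.measurable s hsT).aemeasurable
    ((hY.measurable _ hstT).sub (hY.measurable s hsT)).aemeasurable
  have hmap : P.map (Y (s + t) - Y s) = P.map (Y t) := hdist.map_eq
  simp only [add_sub_cancel] at hadd
  rw [hadd, Pi.mul_apply, hmap]

lemma IsLevyProcess.charFun_zero (hY : IsLevyProcess T Y P ν)
    (y : EuclideanSpace ℝ (Fin d)) : charFun (P.map (Y 0)) y = 1 := by
  have h : Y 0 =ᵐ[P] fun _ ↦ 0 := hY.zero
  rw [(hasLaw_dirac_of_ae_eq h).map_eq]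
  simp

lemma IsLevyProcess.charFun_nat_mul (hY : IsLevyProcess T Y P ν) (hT : Ici 0 ⊆ T) {t : ℝ}
    (ht : 0 ≤ t) (n : ℕ) (y : EuclideanSpace ℝ (Fin d)) :
    charFun (P.map (Y (n * t))) y = charFun (P.map (Y t)) y ^ n := by
  induction n with
  | zero => simpa using hY.charFun_zero y
  | succ n ih =>
    rw [pow_succ, ← ih, ← hY.charFun_add hT (by positivity) ht]
    push_cast
    ring_nf

lemma IsLevyProcess.tendsto_charFun (hY : IsLevyProcess T Y P ν) (hT : Ici 0 ⊆ T) {t : ℝ}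
    (ht : 0 ≤ t) {u : ℕ → ℝ} (hu : ∀ n, t ≤ u n) (hlim : Tendsto u atTop (𝓝 t))
    (y : EuclideanSpace ℝ (Fin d)) :
    Tendsto (fun n ↦ charFun (P.map (Y (u n))) y) atTop (𝓝 (charFun (P.map (Y t)) y)) := by
  have hmeas (s : ℝ) (hs : 0 ≤ s) : Measurable (Y s) := hY.measurable s (hT hs)
  have hchar (s : ℝ) (hs : 0 ≤ s) :
      charFun (P.map (Y s)) y = ∫ ω, Complex.exp (inner ℝ (Y s ω) y * Complex.I) ∂P := by
    rw [charFun_apply, integral_map (hmeas s hs).aemeasurable (by fun_prop)]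
  rw [hchar t ht]
  simp_rw [fun n ↦ hchar (u n) (ht.trans (hu n))]
  refine tendsto_integral_of_dominated_convergence (fun _ ↦ 1)
    (fun n ↦ ?_) (integrable_const _) (fun n ↦ .of_forall fun ω ↦ ?_) ?_
  · have := hmeas (u n) (ht.trans (hu n))
    fun_prop
  · rw [Complex.norm_exp_ofReal_mul_I]
  · filter_upwards [hY.right_continuous] with ω hω
    have h₁ : Tendsto (fun n ↦ Y (u n) ω) atTop (𝓝 (Y t ω)) :=
      (hω t (hT ht)).tendsto.comp
        (tendsto_nhdsWithin_iff.2 ⟨hlim, .of_forall fun n ↦ hu n⟩)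
    have hc : Continuous fun x : EuclideanSpace ℝ (Fin d) ↦
        Complex.exp (inner ℝ x y * Complex.I) := by fun_prop
    exact (hc.tendsto _).comp h₁

lemma IsLevyProcess.charFun_ne_zero (hY : IsLevyProcess T Y P ν) (hT : Ici 0 ⊆ T)
    (y : EuclideanSpace ℝ (Fin d)) :
    charFun (ν : Measure (EuclideanSpace ℝ (Fin d))) y ≠ 0 := by
  have hlim := hY.tendsto_charFun hT le_rfl (u := fun n : ℕ ↦ 1 / ((n : ℝ) + 1))
    (fun n ↦ by positivity) tendsto_one_div_add_atTop_nhds_zero_nat y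
  rw [hY.charFun_zero] at hlim
  obtain ⟨n, hn⟩ := (hlim.eventually_ne one_ne_zero).exists
  have hpow := hY.charFun_nat_mul hT (t := 1 / ((n : ℝ) + 1)) (by positivity) (n + 1) y
  rw [show ((n + 1 : ℕ) : ℝ) * (1 / ((n : ℝ) + 1)) = 1 by push_cast; field_simp,
    hY.law_one.map_eq] at hpow
  exact hpow ▸ pow_ne_zero _ hn

/-- The characteristic function of `Y t` is the `t`-th power of the one of `Y 1`: for rational `t`
by uniqueness of continuous roots, in general by right continuity of the paths. -/
lemma IsLevyProcess.exists_charFun_eq_exp (hY : IsLevyProcess T Y P ν) (hT : Ici 0 ⊆ T) :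
    ∃ φ : EuclideanSpace ℝ (Fin d) → ℂ, Continuous φ ∧ φ 0 = 0 ∧
      (∀ y, charFun (ν : Measure (EuclideanSpace ℝ (Fin d))) y = Complex.exp (φ y)) ∧
      ∀ t, 0 ≤ t → ∀ y, charFun (P.map (Y t)) y = Complex.exp (t * φ y) := by
  obtain ⟨φ, hφ, hφ0, hνφ⟩ := exists_continuous_log
    (continuous_charFun (μ := (ν : Measure (EuclideanSpace ℝ (Fin d))))) (by simp)
    (hY.charFun_ne_zero hT)
  refine ⟨φ, hφ, hφ0, hνφ, fun t ht y ↦ ?_⟩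
  have hroot (n : ℕ) (hn : n ≠ 0) (z : EuclideanSpace ℝ (Fin d)) :
      charFun (P.map (Y (1 / n))) z = Complex.exp (φ z / n) := by
    have hn' : (n : ℝ) ≠ 0 := mod_cast hn
    have := Measure.isProbabilityMeasure_map (μ := P)
      (hY.measurable (1 / n) (hT (by simp))).aemeasurable
    refine eq_exp_div_of_pow_eq_exp continuous_charFun 
      (by rw [MeasureTheory.charFun_zero, probReal_univ, Complex.ofReal_one]) hφ hφ0 hn
      (fun z ↦ ?_) z
    rw [← hνφ, ← hY.charFun_nat_mul hT (by positivity), mul_one_div_cancel hn',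
      hY.law_one.map_eq]
  -- `t` is approximated from above by the rationals `⌈t (n + 1)⌉ / (n + 1)`
  let u : ℕ → ℝ := fun n ↦ ⌈t * (n + 1 : ℕ)⌉₊ / (n + 1 : ℕ)
  have hu : Tendsto u atTop (𝓝 t) :=
    ((tendsto_nat_ceil_mul_div_atTop ht).comp tendsto_natCast_atTop_atTop).comp
      (tendsto_add_atTop_nat 1)
  have hut (n : ℕ) : t ≤ u n := (le_div_iff₀ (by positivity)).2 (Nat.le_ceil _)
  have hchar (n : ℕ) : charFun (P.map (Y (u n))) y = Complex.exp (u n * φ y) := by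
    have h := hY.charFun_nat_mul hT (t := 1 / ((n + 1 : ℕ) : ℝ)) (by positivity)
      ⌈t * (n + 1 : ℕ)⌉₊ y
    rw [mul_one_div] at h
    rw [h, hroot _ n.succ_ne_zero, ← Complex.exp_nat_mul]
    simp only [u]
    push_cast
    ring_nf
  have h₁ := hY.tendsto_charFun hT ht hut hu y
  simp_rw [hchar] at h₁
  have h₂ : Tendsto (fun n ↦ Complex.exp (u n * φ y)) atTop (𝓝 (Complex.exp (t * φ y))) := by
    have hc : Continuous fun s : ℝ ↦ Complex.exp (s * φ y) := by fun_prop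
    exact (hc.tendsto t).comp hu
  exact tendsto_nhds_unique h₁ h₂

lemma IsLevyProcess.hasLawIn (hY : IsLevyProcess T Y P ν) (hT : Ici 0 ⊆ T)
    (hdil : ∀ (a : ℝ), ∀ ν ∈ K, dilation a ν ∈ K)
    (hpow : ∀ (c : ℝ), 0 < c → ∀ ν ∈ K, ∀ μ, IsConvPower ν c μ → μ ∈ K) (hν : ν ∈ K)
    {t : ℝ} (ht : 0 ≤ t) : HasLawIn K (Y t) P := by
  rcases ht.eq_or_lt with rfl | ht'
  · exact (hasLawIn_zero hdil hν).congr hY.zero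
  obtain ⟨φ, hφ, hφ0, hνφ, hYφ⟩ := hY.exists_charFun_eq_exp hT
  have hm : AEMeasurable (Y t) P := (hY.measurable t (hT ht)).aemeasurable
  exact ⟨⟨P.map (Y t), Measure.isProbabilityMeasure_map hm⟩,
    hpow t ht' ν hν _ ⟨φ, hφ, hφ0, hνφ, hYφ t ht⟩, hm, rfl⟩

lemma IsLevyProcess.hasLawIn_sub (hY : IsLevyProcess T Y P ν) (hT : Ici 0 ⊆ T)
    (hdil : ∀ (a : ℝ), ∀ ν ∈ K, dilation a ν ∈ K)
    (hpow : ∀ (c : ℝ), 0 < c → ∀ ν ∈ K, ∀ μ, IsConvPower ν c μ → μ ∈ K) (hν : ν ∈ K)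
    {s t : ℝ} (hs : s ∈ T) (ht : t ∈ T) (hst : s ≤ t) : HasLawIn K (Y t - Y s) P := by
  obtain ⟨ρ, hρ, hlaw⟩ := hY.hasLawIn hT hdil hpow hν (sub_nonneg.2 hst)
  have h := hY.stationary_increments s hs t ht hst
  exact ⟨ρ, hρ, h.aemeasurable_fst, h.map_eq.trans hlaw.map_eq⟩

/-- A linear combination of values of a Lévy process is a linear combination of increments over
consecutive, hence disjoint, time intervals, so that it is a sum of independent random vectors. -/
lemma IsLevyProcess.hasLawIn_of_mem_incrementSpan (hY : IsLevyProcess T Y P ν) (hT : Ici 0 ⊆ T)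
    (hconv : ∀ μ ∈ K, ∀ ν ∈ K, RandomIntegral.conv μ ν ∈ K)
    (hdil : ∀ (a : ℝ), ∀ ν ∈ K, dilation a ν ∈ K)
    (hpow : ∀ (c : ℝ), 0 < c → ∀ ν ∈ K, ∀ μ, IsConvPower ν c μ → μ ∈ K) (hν : ν ∈ K)
    (hX : X ∈ incrementSpan T Y) : HasLawIn K X P := by
  classical
  obtain ⟨A, hAT, hXA⟩ := Submodule.mem_span_finite_of_mem_span hX
  obtain ⟨s, hsT, rfl⟩ := Finset.subset_set_image_iff.1 hAT
  -- list the times involved, and the time `0`, in increasing order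
  let s' : Finset ℝ := insert 0 s
  have h0s' : (0 : ℝ) ∈ s' := Finset.mem_insert_self _ _
  have hs'T : ∀ t ∈ s', t ∈ T := by
    intro t ht
    rcases Finset.mem_insert.1 ht with rfl | ht
    exacts [hT self_mem_Ici, hsT ht]
  obtain ⟨n, hn⟩ : ∃ n, s'.card = n + 1 :=
    ⟨s'.card - 1, by have := Finset.card_pos.2 ⟨_, h0s'⟩; omega⟩
  let τ : Fin (n + 1) ↪o ℝ := s'.orderEmbOfFin hn
  have hτ (i : Fin (n + 1)) : τ i ∈ T := hs'T _ (s'.orderEmbOfFin_mem hn i)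
  have hτs (t : ℝ) (ht : t ∈ s') : ∃ i, τ i = t := by
    have : t ∈ range τ := by rw [Finset.range_orderEmbOfFin]; exact ht
    exact this
  let D : Fin n → Ω → EuclideanSpace ℝ (Fin d) := fun i ↦ Y (τ i.succ) - Y (τ i.castSucc)
  have hbase (i : Fin (n + 1)) : Y (τ i) - Y (τ 0) ∈ Submodule.span ℝ (range D) := by
    induction i using Fin.induction with
    | zero => simp
    | succ i ih =>
      have := Submodule.add_mem _ (Submodule.subset_span (mem_range_self (f := D) i)) ih
      simpa [D] using this
  have hXD : X ∈ Submodule.span ℝ (range D) := by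
    refine Submodule.span_le.2 (fun Z hZ ↦ ?_) hXA
    simp only [Finset.coe_image, mem_image] at hZ
    obtain ⟨t, ht, rfl⟩ := hZ
    obtain ⟨i, hi⟩ := hτs t (Finset.mem_insert_of_mem ht)
    obtain ⟨k, hk⟩ := hτs 0 h0s'
    have := Submodule.sub_mem _ (hbase i) (hbase k)
    rw [hi, hk] at this
    simpa using this
  obtain ⟨c, rfl⟩ := (Submodule.mem_span_range_iff_exists_fun ℝ).1 hXD
  have hindep : iIndepFun D P := hY.indep_increments n (fun i ↦ ⟨τ i, hτ i⟩)
    fun i j hij ↦ τ.monotone hij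
  have hindep' : iIndepFun (fun i ↦ c i • D i) P :=
    hindep.comp (fun i x ↦ c i • x) fun i ↦ measurable_const_smul (c i)
  refine HasLawIn.sum hconv hdil hν (fun i ↦ ?_) (fun i ↦ ?_) hindep'
  · exact ((hY.measurable _ (hτ _)).sub (hY.measurable _ (hτ _))).const_smul (c i)
  · exact (hY.hasLawIn_sub hT hdil hpow hν (hτ _) (hτ _)
      (τ.monotone (Fin.castSucc_lt_succ).le)).const_smul hdil (c i)

end LevyProcess

/-! ### The random integral -/

section RandomIntegral

variable {d : ℕ} {Ω : Type*} {Y : ℝ → Ω → EuclideanSpace ℝ (Fin d)} {h r : ℝ → ℝ} {a b : ℝ}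

/-- The largest multiple of `1 / (n + 1)` that is less than `t`, projected to `[a, b]`. -/
noncomputable def gridPoint (a b : ℝ) (n : ℕ) (t : ℝ) : ℝ :=
  max a (min b ((⌈t * (n + 1)⌉ - 1) / (n + 1)))

lemma gridPoint_mem_Icc (hab : a ≤ b) (n : ℕ) (t : ℝ) : gridPoint a b n t ∈ Icc a b :=
  ⟨le_max_left _ _, max_le hab (min_le_left _ _)⟩

lemma tendsto_gridPoint {t : ℝ} (ht : t ∈ Ioc a b) :
    Tendsto (fun n ↦ gridPoint a b n t) atTop (𝓝[<] t) := by
  have hlt (n : ℕ) : ((⌈t * (n + 1)⌉ - 1) / (n + 1) : ℝ) < t := by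
    rw [div_lt_iff₀ (by positivity)]
    linarith [Int.ceil_lt_add_one (t * ((n : ℝ) + 1))]
  have hlt' (n : ℕ) : gridPoint a b n t < t :=
    max_lt ht.1 ((min_le_right _ _).trans_lt (hlt n))
  refine tendsto_nhdsWithin_iff.2 ⟨?_, .of_forall hlt'⟩
  refine tendsto_of_tendsto_of_tendsto_of_le_of_le (g := fun n : ℕ ↦ t - 1 / ((n : ℝ) + 1))
    ?_ tendsto_const_nhds (fun n ↦ ?_) fun n ↦ (hlt' n).le
  · simpa using tendsto_one_div_add_atTop_nhds_zero_nat.const_sub t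
  · have hpos : (0 : ℝ) < 1 / ((n : ℝ) + 1) := by positivity
    refine le_max_of_le_right (le_min (by linarith [ht.2]) ?_)
    rw [le_div_iff₀ (by positivity), sub_mul, one_div_mul_cancel (by positivity)]
    linarith [Int.le_ceil (t * ((n : ℝ) + 1))]

lemma tendsto_gridPoint_integrand {ω : Ω} {t : ℝ} (ht : t ∈ Ioc a b)
    (hlim : ∃ l, Tendsto (fun s ↦ Y (r s) ω) (𝓝[<] t) (𝓝 l)) :
    Tendsto (fun n ↦ (Y (r (gridPoint a b n t)) - Y (r a)) ω) atTop
      (𝓝 (integrand r a Y ω t)) :=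
  ((tendsto_leftLim_of_tendsto hlim).comp (tendsto_gridPoint ht)).sub_const _

variable [MeasurableSpace Ω] {P : Measure Ω} {T : Set ℝ}
  {ν : ProbabilityMeasure (EuclideanSpace ℝ (Fin d))}

lemma IsWellDefined.integrand_mem_aeLimits (hwd : IsWellDefined T h r a b Y P) (hab : a < b)
    {t : ℝ} (ht : t ∈ Ioc a b) :
    (fun ω ↦ integrand r a Y ω t) ∈ aeLimits (incrementSpan T Y) P := by
  refine ⟨fun n ↦ Y (r (gridPoint a b n t)) - Y (r a), fun n ↦ ?_, ?_⟩
  · exact sub_mem_incrementSpan (hwd.mapsTo (left_mem_Icc.2 hab.le))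
      (hwd.mapsTo (gridPoint_mem_Icc hab.le n t))
  · filter_upwards [hwd.left_limits] with ω hω using tendsto_gridPoint_integrand ht (hω t ht)

lemma measurable_countable_index {S ι E : Type*} [MeasurableSpace S] [Countable ι]
    [MeasurableSpace ι] [MeasurableSingletonClass ι] [MeasurableSpace E] {X : ι → Ω → E}
    (hX : ∀ i, Measurable (X i)) {k : S → ι} (hk : Measurable k) :
    Measurable fun x : Ω × S ↦ X (k x.2) x.1 := by
  have h₁ : Measurable fun x : Ω × ι ↦ X x.2 x.1 := measurable_from_prod_countable_left hX
  have h₂ : Measurable fun x : Ω × S ↦ (x.1, k x.2) :=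
    measurable_fst.prodMk (hk.comp measurable_snd)
  exact h₁.comp h₂

/-- The integrand has a jointly measurable version: the grid approximations are jointly measurable
since they involve only countably many times. -/
lemma IsWellDefined.exists_measurable_integrand (hwd : IsWellDefined T h r a b Y P)
    (hY : IsLevyProcess T Y P ν) (hab : a < b) :
    ∃ F : Ω × ℝ → EuclideanSpace ℝ (Fin d), Measurable F ∧
      ∀ᵐ ω ∂P, ∀ t ∈ Ioc a b, F (ω, t) = integrand r a Y ω t := by
  let G : ℕ → Ω × ℝ → EuclideanSpace ℝ (Fin d) :=
    fun n x ↦ (Y (r (gridPoint a b n x.2)) - Y (r a)) x.1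
  have hG (n : ℕ) : Measurable (G n) := by
    let X : ℤ → Ω → EuclideanSpace ℝ (Fin d) :=
      fun k ↦ Y (r (max a (min b ((k - 1) / (n + 1))))) - Y (r a)
    have hX (k : ℤ) : Measurable (X k) :=
      (hY.measurable _ (hwd.mapsTo ⟨le_max_left _ _, max_le hab.le (min_le_left _ _)⟩)).sub
        (hY.measurable _ (hwd.mapsTo (left_mem_Icc.2 hab.le)))
    exact measurable_countable_index hX (k := fun t : ℝ ↦ ⌈t * ((n : ℝ) + 1)⌉)
      (measurable_id.mul_const _).ceil
  refine ⟨fun x ↦ limUnder atTop (G · x),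
    (StronglyMeasurable.limUnder fun n ↦ (hG n).stronglyMeasurable).measurable, ?_⟩
  filter_upwards [hwd.left_limits] with ω hω t ht
  exact (tendsto_gridPoint_integrand ht (hω t ht)).limUnder_eq

lemma IsWellDefined.randomIntegral_mem_aeLimits [IsFiniteMeasure P]
    (hwd : IsWellDefined T h r a b Y P) (hY : IsLevyProcess T Y P ν) (hT : Ici 0 ⊆ T)
    (hab : a < b) : randomIntegral h r a b Y ∈ aeLimits (incrementSpan T Y) P := by
  obtain ⟨F, hF, hFint⟩ := hwd.exists_measurable_integrand hY hab
  set σ := (stieltjes h a b).restrict (Ioc a b) with hσ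
  have hae : ∀ᵐ t ∂σ.variation, t ∈ Ioc a b := by
    rw [hσ, VectorMeasure.variation_restrict measurableSet_Ioc]
    exact ae_restrict_mem measurableSet_Ioc
  have hFσ : ∀ᵐ ω ∂P, (fun t ↦ F (ω, t)) =ᵐ[σ.variation] integrand r a Y ω := by
    filter_upwards [hFint] with ω hω
    filter_upwards [hae] with t ht using hω t ht
  have hmem : (fun ω ↦ ∫ᵛ t, F (ω, t) ∂<•σ) ∈ aeLimits (incrementSpan T Y) P := by
    refine integral_signedMeasure_mem_aeLimits
      (fun X hX ↦ (hY.measurable_of_mem_incrementSpan hT hX).aemeasurable) hF ?_ ?_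
    · filter_upwards [hFσ, hwd.integrable] with ω h₁ h₂
      exact (integrable_congr h₁).2 h₂
    · filter_upwards [hae] with t ht
      refine aeLimits_congr (hwd.integrand_mem_aeLimits hab ht) ?_
      filter_upwards [hFint] with ω hω using (hω t ht).symm
  have hincr : Y (r b) - Y (r a) ∈ aeLimits (incrementSpan T Y) P :=
    le_aeLimits (sub_mem_incrementSpan (hwd.mapsTo (left_mem_Icc.2 hab.le))
      (hwd.mapsTo (right_mem_Icc.2 hab.le)))
  refine aeLimits_congr (Submodule.sub_mem _ (Submodule.smul_mem _ (h b) hincr) hmem) ?_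
  filter_upwards [hFσ] with ω hω
  simp only [randomIntegral, Pi.sub_apply, Pi.smul_apply]
  rw [VectorMeasure.integral_congr_ae hω]

/-- Limits in distribution of random vectors with laws in the closed set `K` have their law
in `K`. -/
lemma ConvergesInLaw.mem_of_eventually_hasLawIn
    {K : Set (ProbabilityMeasure (EuclideanSpace ℝ (Fin d)))} (hclosed : IsClosed K)
    {ι : Type*} {l : Filter ι} [l.NeBot] {X : ι → Ω → EuclideanSpace ℝ (Fin d)}
    {ρ : ProbabilityMeasure (EuclideanSpace ℝ (Fin d))} (hX : ∀ᶠ i in l, HasLawIn K (X i) P)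
    (hlim : ConvergesInLaw X l P ρ) : ρ ∈ K := by
  classical
  let μ : ι → ProbabilityMeasure (EuclideanSpace ℝ (Fin d)) :=
    fun i ↦ if hi : HasLawIn K (X i) P then hi.choose else ρ
  have hμ : ∀ᶠ i in l, μ i ∈ K ∧
      HasLaw (X i) (μ i : Measure (EuclideanSpace ℝ (Fin d))) P := by
    filter_upwards [hX] with i hi
    simp only [μ, dif_pos hi]
    exact hi.choose_spec
  refine hclosed.mem_of_tendsto (b := l) (f := μ) ?_ (hμ.mono fun _ hi ↦ hi.1)
  refine ProbabilityMeasure.tendsto_iff_forall_integral_tendsto.2 fun f ↦ ?_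
  refine (hlim f).congr' ?_
  filter_upwards [hμ] with i hi
  exact hi.2.integral_comp f.continuous.aestronglyMeasurable

end RandomIntegral

end RandomIntegral

theorem proposition1 {d : ℕ} (K : Set (ProbabilityMeasure (EuclideanSpace ℝ (Fin d))))
    (hID : ∀ ν ∈ K, IsInfinitelyDivisible ν)
    (hclosed : IsClosed K)
    (hconv : ∀ μ ∈ K, ∀ ν ∈ K, RandomIntegral.conv μ ν ∈ K)
    (hdil : ∀ (a : ℝ), ∀ ν ∈ K, dilation a ν ∈ K)
    (hpow : ∀ (c : ℝ), 0 < c → ∀ ν ∈ K, ∀ μ, IsConvPower ν c μ → μ ∈ K)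
    {Ω : Type*} [MeasurableSpace Ω] (P : Measure Ω) [IsProbabilityMeasure P]
    (T : Set ℝ) (hT : T = Ici 0 ∨ T = univ)
    (ν : ProbabilityMeasure (EuclideanSpace ℝ (Fin d))) (hν : ν ∈ K)
    (Y : ℝ → Ω → EuclideanSpace ℝ (Fin d)) (hY : IsLevyProcess T Y P ν)
    (h r : ℝ → ℝ) :
    -- finite intervals `(a, b]`
    (∀ a b : ℝ, a < b → IsWellDefined T h r a b Y P →
      ∃ ρ ∈ K, HasLaw (randomIntegral h r a b Y) (ρ : Measure (EuclideanSpace ℝ (Fin d))) P) ∧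
    -- half-lines `(a, ∞)`
    (∀ (a : ℝ) (ρ : ProbabilityMeasure (EuclideanSpace ℝ (Fin d))),
      (∀ b, a < b → IsWellDefined T h r a b Y P) →
      ConvergesInLaw (fun b ↦ randomIntegral h r a b Y) atTop P ρ → ρ ∈ K) ∧
    -- half-lines `(-∞, b]`
    (∀ (b : ℝ) (ρ : ProbabilityMeasure (EuclideanSpace ℝ (Fin d))),
      (∀ a, a < b → IsWellDefined T h r a b Y P) →
      ConvergesInLaw (fun a ↦ randomIntegral h r a b Y) atBot P ρ → ρ ∈ K) ∧
    -- the line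
    (∀ ρ : ProbabilityMeasure (EuclideanSpace ℝ (Fin d)),
      (∀ a b, a < b → IsWellDefined T h r a b Y P) →
      ConvergesInLaw (fun p : ℝ × ℝ ↦ randomIntegral h r p.1 p.2 Y) (atBot ×ˢ atTop) P ρ →
      ρ ∈ K) := by
  have hT0 : Ici 0 ⊆ T := by rcases hT with rfl | rfl <;> simp
  have hfin (a b : ℝ) (hab : a < b) (hwd : IsWellDefined T h r a b Y P) :
      HasLawIn K (randomIntegral h r a b Y) P := by
    obtain ⟨u, hu, hlim⟩ := hwd.randomIntegral_mem_aeLimits hY hT0 hab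
    exact HasLawIn.of_ae_tendsto hclosed
      (fun n ↦ hY.hasLawIn_of_mem_incrementSpan hT0 hconv hdil hpow hν (hu n)) hlim
  refine ⟨hfin, fun a ρ hwd hlim ↦ ?_, fun b ρ hwd hlim ↦ ?_, fun ρ hwd hlim ↦ ?_⟩
  · refine hlim.mem_of_eventually_hasLawIn hclosed ?_
    filter_upwards [eventually_gt_atTop a] with b hb using hfin a b hb (hwd b hb)
  · refine hlim.mem_of_eventually_hasLawIn hclosed ?_
    filter_upwards [eventually_lt_atBot b] with a ha using hfin a b ha (hwd a ha)
  · refine hlim.mem_of_eventually_hasLawIn hclosed ?_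
    have h₁ : ∀ᶠ p : ℝ × ℝ in atBot ×ˢ atTop, p.1 < 0 ∧ 0 < p.2 :=
      (eventually_lt_atBot 0).prod_mk (eventually_gt_atTop 0)
    filter_upwards [h₁] with p hp
    exact hfin p.1 p.2 (hp.1.trans hp.2) (hwd _ _ (hp.1.trans hp.2))
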